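/- Let $\omega=e^{2\pi i/3}$. A $\mathbb Z_3$-space is a topological space with a continuous self-map, also written $\omega$, whose third iterate is the identity; a continuous map $f$ between $\mathbb Z_3$-spaces is equivariant if $f\omega=\omega f$, and two maps $X\to Y$ are equivariantly homotopic if there is a homotopy $h\colon X\times[0,1]\to Y$ between them such that every $h(\cdot,t)$ is equivariant. Let $\mathbb Z_3$ act on the unit circle $S^1\subset\mathbb C$ by $z\mapsto\omega z$ and on the torus $T^n=(S^1)^n$ diagonally. Let $P^2$ be a $\mathbb Z_3$-space obtained as follows. Let $Y_2$ be the circle $S^1$ with three $2$-discs $d_0,d_1,d_2$ glued on, $d_j$ along the map $\partial D^2=S^1\to S^1$, $z\mapsto\omega^jz$; the generator $\omega$ rotates the circle by $2\pi/3$ and maps $d_j$ identically to $d_{j+1}$ (indices modulo $3$). Put $Y_3=Y_2$. For $k\ge 3$, fix based maps $\gamma_i\colon S^k\to Y_k$ whose classes generate $\pi_k(Y_k)$, and let $Y_{k+1}$ be $Y_k$ with three $(k+1)$-discs glued on for each $i$, along $\gamma_i$, $\omega\gamma_i$ and $\omega^2\gamma_i$; the action is extended by permuting these three discs cyclically. Finally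 $P^2=\bigcup_k Y_k$ with the direct limit topology. Fix an equivariant embedding $\iota\colon S^1\hookrightarrow P^2$ (for example the inclusion of $S^1\subset Y_2$). For $n\ge 1$ let $$\mathscr Z_3^{(n)}=\Bigl\{\alpha\in\mathbb Z_3^n : \sum_{i=1}^n\alpha_i=1\Bigr\},$$ and for $\alpha\in\mathscr Z_3^{(n)}$, with its entries represented by integers $\alpha_i\in\{0,1,2\}$, let $m_\alpha\colon T^n\to P^2$ be the monomial map $$m_\alpha(z_1,\dots,z_n)=\iota\bigl(z_1^{\alpha_1}\cdots z_n^{\alpha_n}\bigr).$$ **Lemma.** Let $\alpha,\beta\in\mathscr Z_3^{(n)}$. If $m_\alpha$ and $m_\beta$ are equivariantly homotopic, then $\alpha=\beta$. -/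

import Mathlib

open Metric

/-- A topological space with an action of the cyclic group of order three, given by the
continuous map `ω` through which the generator acts. The base point is not required to be fixed
by anything; it serves only to speak of homotopy groups. -/
structure Z3Space where
  carrier : Type
  [top : TopologicalSpace carrier]
  pt : carrier
  ω : C(carrier, carrier)
  ω_cube : ∀ x, ω (ω (ω x)) = x

instance : CoeSort Z3Space Type := ⟨Z3Space.carrier⟩

attribute [instance] Z3Space.top

namespace Z3Space

/-- A continuous map that commutes with the actions. -/
def IsEquivariant {X Y : Z3Space} (f : C(X, Y)) : Prop :=
  ∀ x, f (X.ω x) = Y.ω (f x)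

/-- Existence of a homotopy all of whose stages are equivariant. -/
def EquivariantlyHomotopic {X Y : Z3Space} (f g : C(X, Y)) : Prop :=
  ∃ h : ContinuousMap.Homotopy f g, ∀ t x, h (t, X.ω x) = Y.ω (h (t, x))

section Attach

variable (Y : Z3Space) {E : Type} [NormedAddCommGroup E] {I : Type}
  (γ : I → C(sphere (0 : E) 1, Y))

/-- A boundary point `x` of the `j`-th disc belonging to `γ i` is glued to `ω ^ j • γ i x`. -/
inductive AttachRel :
    (Y ⊕ (Σ _ : I × ZMod 3, closedBall (0 : E) 1)) →
      (Y ⊕ (Σ _ : I × ZMod 3, closedBall (0 : E) 1)) → Prop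
  | glue (i : I) (j : ZMod 3) (x : sphere (0 : E) 1) :
      AttachRel (Sum.inr ⟨(i, j), ⟨x.1, sphere_subset_closedBall x.2⟩⟩)
        (Sum.inl (Y.ω^[j.val] (γ i x)))

theorem attach_shift (j : ZMod 3) (y : Y) :
    Y.ω^[(j + 1).val] y = Y.ω (Y.ω^[j.val] y) := by
  fin_cases j
  · rfl
  · rfl
  · exact (Y.ω_cube y).symm

/-- The action on the disjoint union of `Y` and the discs: `ω` on `Y`, and the `j`-th disc of
each orbit goes identically to the `(j + 1)`-st. -/
def preAttachω (p : Y ⊕ (Σ _ : I × ZMod 3, closedBall (0 : E) 1)) :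
    Y ⊕ (Σ _ : I × ZMod 3, closedBall (0 : E) 1) :=
  Sum.map Y.ω (Sigma.map (fun a => (a.1, a.2 + 1)) (fun _ x => x)) p

theorem continuous_preAttachω :
    Continuous (preAttachω Y : Y ⊕ (Σ _ : I × ZMod 3, closedBall (0 : E) 1) → _) :=
  Continuous.sumMap Y.ω.continuous (Continuous.sigma_map fun _ => continuous_id)

theorem attachRel_preAttachω {p q : Y ⊕ (Σ _ : I × ZMod 3, closedBall (0 : E) 1)}
    (h : AttachRel Y γ p q) : AttachRel Y γ (preAttachω Y p) (preAttachω Y q) := by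
  cases h with
  | glue i j x =>
    have := AttachRel.glue (γ := γ) i (j + 1) x
    rw [attach_shift] at this
    exact this

/-- The space obtained from `Y` by gluing, for each `i`, three copies of the unit disc of `E`
along `γ i`, `ω • γ i` and `ω ^ 2 • γ i`, with the quotient topology; the action permutes the
three discs cyclically. -/
def attach : Z3Space where
  carrier := Quot (AttachRel Y γ)
  top := inferInstance
  pt := Quot.mk _ (Sum.inl Y.pt)
  ω := ⟨Quot.map (preAttachω Y) fun _ _ h => attachRel_preAttachω Y γ h,
    continuous_quot_lift _ (continuous_quot_mk.comp (continuous_preAttachω Y))⟩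
  ω_cube := by
    rintro ⟨y | ⟨⟨i, j⟩, x⟩⟩
    · exact congrArg (fun z => Quot.mk _ (Sum.inl z)) (Y.ω_cube y)
    · have : j + 1 + 1 + 1 = j := by revert j; decide
      exact congrArg (fun k => Quot.mk (AttachRel Y γ) (Sum.inr ⟨(i, k), x⟩)) this

/-- The inclusion of `Y` into the space with discs glued on. -/
def attachIncl : C(Y, attach Y γ) :=
  ⟨fun y => Quot.mk _ (Sum.inl y), continuous_quot_mk.comp continuous_inl⟩

end Attach

end Z3Space

open Z3Space

noncomputable section

/-- The primitive cube root of unity `exp (2 π i / 3)`. -/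
def omega3 : Circle := Circle.exp (2 * Real.pi / 3)

theorem omega3_cube : omega3 * (omega3 * omega3) = 1 := by
  rw [omega3, ← Circle.exp_add, ← Circle.exp_add, ← Circle.exp_two_pi]
  congr 1
  ring

/-- The torus `(S¹)ⁿ`, with the diagonal rotation by `2 π / 3`. -/
def torus (n : ℕ) : Z3Space where
  carrier := Fin n → Circle
  pt := 1
  ω := ⟨fun z i => omega3 * z i, by fun_prop⟩
  ω_cube z := by
    funext i
    simp only [ContinuousMap.coe_mk]
    rw [← mul_assoc, ← mul_assoc, mul_assoc omega3, omega3_cube, one_mul]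

/-- The circle with the rotation by `2 π / 3`. -/
def circle3 : Z3Space where
  carrier := Circle
  pt := 1
  ω := ⟨fun z => omega3 * z, by fun_prop⟩
  ω_cube z := by
    simp only [ContinuousMap.coe_mk]
    rw [← mul_assoc, ← mul_assoc, mul_assoc omega3, omega3_cube, one_mul]

/-- The boundary of the unit disc in `ℂ`, identified with the circle. -/
def sphereToCircle : C(sphere (0 : ℂ) 1, circle3) :=
  ⟨fun x => (⟨x.1, x.2⟩ : Circle), Continuous.subtype_mk continuous_subtype_val _⟩

/-- The circle with three discs glued along it, the `j`-th one by the rotation `z ↦ ω ^ j z`;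
the action rotates the circle and permutes the discs cyclically. -/
def Y2 : Z3Space := attach circle3 (fun _ : Unit => sphereToCircle)

/-- An identification of the `k`-sphere, with base point `pole`, with the cube modulo its
boundary. -/
structure CubeCollapse (k : ℕ) where
  map : C(Fin k → unitInterval, sphere (0 : EuclideanSpace ℝ (Fin (k + 1))) 1)
  pole : sphere (0 : EuclideanSpace ℝ (Fin (k + 1))) 1
  map_eq_pole_iff : ∀ x, map x = pole ↔ x ∈ Cube.boundary (Fin k)
  injOn : Set.InjOn map (Cube.boundary (Fin k))ᶜ
  surjective : Function.Surjective map

/-- The element of the `k`-th homotopy group represented by a based map from the `k`-sphere. -/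
def CubeCollapse.toHomotopyGroup {k : ℕ} (q : CubeCollapse k) {Y : Type} [TopologicalSpace Y]
    {y : Y} (γ : C(sphere (0 : EuclideanSpace ℝ (Fin (k + 1))) 1, Y)) (hγ : γ q.pole = y) :
    HomotopyGroup (Fin k) Y y :=
  Quotient.mk _ ⟨γ.comp q.map, fun x hx =>
    (congrArg γ ((q.map_eq_pole_iff x).2 hx)).trans hγ⟩

/-- A family of based maps from the `k`-sphere whose classes generate the `k`-th homotopy group
of `Y`. -/
structure SphereGenerators (k : ℕ) [NeZero k] (Y : Z3Space) where
  collapse : CubeCollapse k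
  Index : Type
  γ : Index → C(sphere (0 : EuclideanSpace ℝ (Fin (k + 1))) 1, Y)
  based : ∀ i, γ i collapse.pole = Y.pt
  generate :
    Subgroup.closure (Set.range fun i => collapse.toHomotopyGroup (γ i) (based i)) = ⊤

/-- A rule that fixes representatives of generators for all homotopy groups `π_k`, `k ≥ 3`, that
can come up in the inductive construction below. -/
def GeneratorChoice : Type 1 :=
  ∀ (m : ℕ) (Y : Z3Space), SphereGenerators (m + 3) Y

/-- The skeleta `Y_{m + 3}`: one starts from `Y_3 = Y_2`, and `Y_{k + 1}` arises from `Y_k` by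
gluing three `(k + 1)`-discs for each of the chosen generators of `π_k(Y_k)`. -/
def skeleton (c : GeneratorChoice) : ℕ → Z3Space
  | 0 => Y2
  | m + 1 => attach (skeleton c m) (c m (skeleton c m)).γ

/-- The inclusion of each skeleton into the next. -/
def skeletonIncl (c : GeneratorChoice) (m : ℕ) : C(skeleton c m, skeleton c (m + 1)) :=
  attachIncl (skeleton c m) (c m (skeleton c m)).γ

/-- A point of a skeleton is identified with its image in the next one. -/
inductive UnionRel (c : GeneratorChoice) :
    (Σ m, skeleton c m) → (Σ m, skeleton c m) → Prop
  | step (m : ℕ) (y : skeleton c m) : UnionRel c ⟨m, y⟩ ⟨m + 1, skeletonIncl c m y⟩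

/-- The action on the disjoint union of the skeleta. -/
def preUnionω (c : GeneratorChoice) : (Σ m, skeleton c m) → (Σ m, skeleton c m) :=
  Sigma.map id fun m => (skeleton c m).ω

theorem continuous_preUnionω (c : GeneratorChoice) : Continuous (preUnionω c) :=
  Continuous.sigma_map (σ := fun m => skeleton c m) (τ := fun m => skeleton c m)
    fun m => (skeleton c m).ω.continuous

/-- The space `P²`: the union of the skeleta, with the weak (direct limit) topology. -/
def P2 (c : GeneratorChoice) : Z3Space where
  carrier := Quot (UnionRel c)
  top := inferInstance
  pt := Quot.mk _ ⟨0, (skeleton c 0).pt⟩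
  ω := ⟨Quot.map (preUnionω c) (by
      rintro _ _ ⟨m, y⟩
      exact UnionRel.step m ((skeleton c m).ω y)),
    continuous_quot_lift _ (continuous_quot_mk.comp (continuous_preUnionω c))⟩
  ω_cube := by
    rintro ⟨m, y⟩
    exact congrArg (fun z => Quot.mk (UnionRel c) ⟨m, z⟩) ((skeleton c m).ω_cube y)

/-- The `n`-ary affine maps modulo `3`, as coefficient tuples with sum `1`. -/
def AffineTuples (n : ℕ) : Set (Fin n → ZMod 3) := {α | ∑ i, α i = 1}

/-- The monomial `z ↦ z₁ ^ a₁ ⋯ zₙ ^ aₙ` on the torus. -/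
def monomial {n : ℕ} (a : Fin n → ℤ) : C(Fin n → Circle, Circle) :=
  ⟨fun z => ∏ i, z i ^ a i,
    continuous_finsetProd _ fun i _ => (continuous_apply i).zpow (a i)⟩

/-- The map `z ↦ ι (z₁ ^ a₁ ⋯ zₙ ^ aₙ)` for integer exponents. -/
def monomialMap {P : Z3Space} (ι : C(circle3, P)) {n : ℕ} (a : Fin n → ℤ) : C(torus n, P) :=
  ContinuousMap.comp (β := circle3) ι (monomial a)

/-- The monomial map of a tuple modulo `3`, with the exponents taken in `{0, 1, 2}`. -/
def monomialMap3 {P : Z3Space} (ι : C(circle3, P)) {n : ℕ} (α : Fin n → ZMod 3) :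
    C(torus n, P) :=
  monomialMap ι fun i => ((α i).val : ℤ)

end

/-!
Let `H` be an infinite-dimensional Hilbert space. Since `H \ {0}` is contractible, the space of
nonzero pure tensors `x ⊗ y ⊗ z` in `H ⊗ H ⊗ H` is a quotient of a contractible space of triples by
the group of scalars with product one, whose fundamental group is `ℤ²`; so it is a `K(ℤ², 2)`. The
cyclic permutation of the factors, followed by multiplication by `ω`, is an action of order three.
The map `z ↦ (z • e) ⊗ e ⊗ e` from the circle is equivariant and null-homotopic, and the homotopy
groups that matter for the remaining cells vanish, so it extends to an equivariant map on `P²`. It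
therefore suffices to tell apart monomial maps with values in the space of pure tensors.

Restrict an equivariant map on the torus to a square that runs along the diagonal from `z` to `ω z`
in one direction, and once around the `i`-th circle in the other. Opposite sides of the square are
identified, by the identity and by the action. A lift of it to triples has monodromies along both
pairs of sides, with values in `ℂ²`, the universal cover of the group of scalars, and the failure of
these to commute is a period, that is, an element of `(2πi ℤ)²`. Another lift changes it by an
element of the form `m - T m` with a period `m`, where `T` is the linear map by which the action
twists `ℂ²`, and a homotopy does not change it. These elements `m - T m` form a subgroup of index
three. For a monomial map one computes the period `(2πi a, 0)`, where `a` is the exponent of the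
`i`-th variable, and so `a` is determined modulo `3`.
-/

noncomputable section

open Complex unitInterval Module Topology Filter
open scoped RealInnerProductSpace

/-! ### Homotopies through nonzero vectors -/

section NonzeroVectors

variable {X V : Type*} [TopologicalSpace X]

theorem homotopic_of_zero_notMem_segment [AddCommGroup V] [TopologicalSpace V]
    [IsTopologicalAddGroup V] [Module ℝ V] [ContinuousSMul ℝ V] (f g : C(X, {v : V // v ≠ 0}))
    (h : ∀ x, (0 : V) ∉ segment ℝ (f x : V) (g x)) : f.Homotopic g := by
  let incl : C({v : V // v ≠ 0}, V) := ⟨Subtype.val, continuous_subtype_val⟩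
  let H := ContinuousMap.Homotopy.affine (incl.comp f) (incl.comp g)
  have hH : ∀ p, H p ≠ 0 := fun p h0 => h p.2 <| by
    rw [segment_eq_image_lineMap]
    exact ⟨p.1, p.1.2, h0⟩
  exact ⟨{ toFun := fun p => ⟨H p, hH p⟩
           continuous_toFun := by fun_prop
           map_zero_left := fun x => Subtype.ext (H.apply_zero x)
           map_one_left := fun x => Subtype.ext (H.apply_one x) }⟩

/-- Kakutani's argument: the identity is deformed along segments to the injective operator `T`,
which misses the line through `e`, and from there to the constant map `e`. -/
theorem contractibleSpace_nonzero_of_notMem_range [AddCommGroup V] [TopologicalSpace V]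
    [IsTopologicalAddGroup V] [Module ℝ V] [ContinuousSMul ℝ V] (T : V →L[ℝ] V) {e : V}
    (hT : ∀ (c : ℝ) (x : V), 0 ≤ c → T x = -(c • x) → x = 0) (he : e ∉ Set.range T) :
    ContractibleSpace {v : V // v ≠ 0} := by
  have hker : ∀ x, T x = 0 → x = 0 := fun x hx => hT 0 x le_rfl (by simpa using hx)
  have he0 : e ≠ 0 := fun h => he ⟨0, by rw [map_zero, h]⟩
  let S : C({v : V // v ≠ 0}, {v : V // v ≠ 0}) :=
    ⟨fun v => ⟨T v, fun h => v.2 (hker v h)⟩, by fun_prop⟩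
  have id_homotopic : (ContinuousMap.id _).Homotopic S := by
    refine homotopic_of_zero_notMem_segment _ _ fun v => ?_
    rintro ⟨a, b, ha, hb, hab, h : a • (v : V) + b • T v = 0⟩
    rcases hb.eq_or_lt with rfl | hb
    · rw [add_zero] at hab
      exact v.2 (by simpa [hab] using h)
    · refine v.2 (hT (b⁻¹ * a) v (by positivity) ?_)
      rw [mul_smul, ← smul_neg, ← eq_neg_of_add_eq_zero_right h, inv_smul_smul₀ hb.ne']
  have homotopic_const : S.Homotopic (.const _ ⟨e, he0⟩) := by
    refine homotopic_of_zero_notMem_segment _ _ fun v => ?_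
    rintro ⟨a, b, -, hb, hab, h : a • T v + b • e = 0⟩
    rcases hb.eq_or_lt with rfl | hb
    · rw [add_zero] at hab
      exact v.2 (hker v (by simpa [hab] using h))
    · refine he ⟨b⁻¹ • -(a • (v : V)), ?_⟩
      rw [map_smul, map_neg, map_smul, ← eq_neg_of_add_eq_zero_right h, inv_smul_smul₀ hb.ne']
  exact (contractible_iff_id_nullhomotopic _).2 ⟨_, id_homotopic.trans homotopic_const⟩

theorem nullhomotopic_of_forall_ne_neg [NormedAddCommGroup V] [NormedSpace ℝ V]
    (f : C(X, sphere (0 : V) 1)) (e : sphere (0 : V) 1) (h : ∀ x, f x ≠ -e) :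
    f.Nullhomotopic := by
  let incl : C(sphere (0 : V) 1, {v : V // v ≠ 0}) :=
    ⟨fun x => ⟨x, ne_zero_of_mem_unit_sphere x⟩, by fun_prop⟩
  have norm_ne_zero (v : {v : V // v ≠ 0}) : ‖(v : V)‖ ≠ 0 := norm_ne_zero_iff.2 v.2
  let normalize : C({v : V // v ≠ 0}, sphere (0 : V) 1) :=
    ⟨fun v => ⟨‖(v : V)‖⁻¹ • v, by simp [norm_smul, norm_ne_zero v]⟩,
      by fun_prop (disch := assumption)⟩
  have normalize_incl : normalize.comp incl = .id _ := by
    ext x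
    simp [normalize, incl]
  have homotopic_const : (incl.comp f).Homotopic (.const X (incl e)) := by
    refine homotopic_of_zero_notMem_segment _ _ fun x => ?_
    rintro ⟨a, b, ha, hb, hab, hx : a • (f x : V) + b • (e : V) = 0⟩
    have hx' := eq_neg_of_add_eq_zero_left hx
    have hnorm := congrArg norm hx'
    rw [norm_neg, norm_smul, norm_smul, norm_eq_of_mem_sphere, norm_eq_of_mem_sphere, mul_one,
      mul_one, Real.norm_of_nonneg ha, Real.norm_of_nonneg hb] at hnorm
    subst hnorm
    have ha : a ≠ 0 := by
      rintro rfl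
      norm_num at hab
    exact h x (Subtype.ext (smul_right_injective V ha (by simpa using hx')))
  refine ⟨normalize (incl e), ?_⟩
  rw [← f.id_comp, ← normalize_incl]
  exact .comp (.refl normalize) homotopic_const

end NonzeroVectors

/-- The Hilbert space of square summable sequences. -/
abbrev SquareSummable : Type := lp (fun _ : ℕ => ℂ) 2

theorem memℓp_inv_succ : Memℓp (fun n : ℕ => ((n : ℂ) + 1)⁻¹) 2 := by
  refine memℓp_gen ?_
  have := (Real.summable_nat_pow_inv (p := 2)).2 one_lt_two
  refine ((summable_nat_add_iff 1).2 this).congr fun n => ?_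
  have : ‖(n : ℂ) + 1‖ = n + 1 := by exact_mod_cast Complex.norm_natCast (n + 1)
  simp [this]

instance : ContractibleSpace {x : SquareSummable // x ≠ 0} := by
  have hnorm (n : ℕ) : ‖((n : ℂ) + 1)⁻¹ • ContinuousLinearMap.id ℂ ℂ‖ ≤ 1 := by
    have : ‖(n : ℂ) + 1‖ = n + 1 := by exact_mod_cast Complex.norm_natCast (n + 1)
    rw [norm_smul, norm_inv, this, ContinuousLinearMap.norm_id, mul_one]
    exact inv_le_one_of_one_le₀ (by simp)
  let T : SquareSummable →L[ℂ] SquareSummable := lp.mapCLM 2 _ zero_le_one hnorm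
  have hT (x : SquareSummable) (n : ℕ) : T x n = ((n : ℂ) + 1)⁻¹ * x n := rfl
  have hpos (n : ℕ) : ((n : ℂ) + 1) ≠ 0 := by exact_mod_cast n.succ_ne_zero
  refine contractibleSpace_nonzero_of_notMem_range (T.restrictScalars ℝ)
    (e := ⟨_, memℓp_inv_succ⟩) (fun c x hc hx => lp.ext (funext fun n => ?_)) ?_
  · have hxn : ((n : ℂ) + 1)⁻¹ * x n = -(c * x n) := (hT x n).symm.trans congr($hx n)
    have : ((n : ℂ) + 1)⁻¹ + c ≠ 0 := by
      simpa using ofReal_ne_zero.2 (show ((n : ℝ) + 1)⁻¹ + c ≠ 0 by positivity)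
    exact (mul_eq_zero.1 (by linear_combination hxn : (((n : ℂ) + 1)⁻¹ + c) * x n = 0)).resolve_left
      this
  · rintro ⟨x, hx⟩
    have hone (n : ℕ) : x n = 1 := by
      have : ((n : ℂ) + 1)⁻¹ * x n = ((n : ℂ) + 1)⁻¹ := congr($hx n)
      exact mul_left_cancel₀ (inv_ne_zero (hpos n)) (by rw [this, mul_one])
    have := (lp.memℓp x).summable (by norm_num)
    simp [hone, summable_const_iff] at this

/-! ### Continuous logarithms -/

section Logarithms

/-- Every continuous nowhere vanishing complex function on `X` has a continuous logarithm. -/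
def AdmitsLog (X : Type*) [TopologicalSpace X] : Prop :=
  ∀ u : C(X, {z : ℂ // z ≠ 0}), ∃ L : C(X, ℂ), ∀ x, exp (L x) = u x

variable {X Y : Type*} [TopologicalSpace X] [TopologicalSpace Y]

theorem exists_log_of_nullhomotopic (u : C(X, {z : ℂ // z ≠ 0})) (hu : u.Nullhomotopic) :
    ∃ L : C(X, ℂ), ∀ x, exp (L x) = u x := by
  obtain ⟨c, ⟨H⟩⟩ := hu
  have hstart : ∀ x, H.symm (0, x) = ⟨exp (ContinuousMap.const X (log c) x), exp_ne_zero _⟩ := by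
    intro x
    ext
    simp [exp_log c.2]
  let lift := isCoveringMap_exp.liftHomotopy H.symm.toContinuousMap _ hstart
  refine ⟨lift.comp ⟨fun x => (1, x), by fun_prop⟩, fun x => ?_⟩
  have := congrFun (isCoveringMap_exp.liftHomotopy_lifts H.symm.toContinuousMap _ hstart) (1, x)
  exact (congrArg Subtype.val this).trans (by simp)

theorem AdmitsLog.of_contractibleSpace [ContractibleSpace X] : AdmitsLog X := fun u =>
  exists_log_of_nullhomotopic u ((id_nullhomotopic X).comp_right u)

theorem AdmitsLog.of_homeomorph (e : X ≃ₜ Y) (h : AdmitsLog Y) : AdmitsLog X := fun u =>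
  let ⟨L, hL⟩ := h (u.comp e.symm)
  ⟨L.comp e, fun x => by simpa using hL (e x)⟩

theorem eq_of_exp_eq_one [PreconnectedSpace X] (f : C(X, ℂ)) (h : ∀ x, exp (f x) = 1) (x y : X) :
    f x = f y :=
  congrFun (isCoveringMap_exp.eq_of_comp_eq f.continuous (continuous_const (y := f y))
    (funext fun z => Subtype.ext ((h z).trans (h y).symm)) y rfl) x

end Logarithms

/-! ### Hemispheres -/

theorem exists_glue_of_eq_on_zero {X Z : Type*} [TopologicalSpace X] [TopologicalSpace Z]
    (s : C(X, ℝ)) (g₁ g₂ : C(X, Z)) (h : ∀ x, s x = 0 → g₁ x = g₂ x) :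
    ∃ g : C(X, Z), (∀ x, 0 ≤ s x → g x = g₁ x) ∧ ∀ x, s x ≤ 0 → g x = g₂ x := by
  classical
  refine ⟨⟨fun x => if 0 ≤ s x then g₁ x else g₂ x, Continuous.if_le g₁.continuous g₂.continuous
    continuous_const s.continuous fun x hx => h x hx.symm⟩, fun x hx => if_pos hx, fun x hx => ?_⟩
  rcases hx.eq_or_lt with h0 | hneg
  · exact (if_pos h0.ge).trans (h x h0)
  · exact if_neg hneg.not_ge

section Hemispheres

variable {E : Type*} [NormedAddCommGroup E] [InnerProductSpace ℝ E] (e : sphere (0 : E) 1)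

/-- The signed height over the hyperplane orthogonal to `e`. -/
def sphereHeight : C(sphere (0 : E) 1, ℝ) := ⟨fun x => ⟪(e : E), x⟫, by fun_prop⟩

theorem sphereHeight_neg (x : sphere (0 : E) 1) : sphereHeight (-e) x = -sphereHeight e x :=
  inner_neg_left _ _

/-- The retraction of the sphere onto the hemisphere around `e` that reflects the other hemisphere
in the hyperplane orthogonal to `e`. -/
def sphereFold : C(sphere (0 : E) 1, sphere (0 : E) 1) where
  toFun x := ⟨(x : E) + (|sphereHeight e x| - sphereHeight e x) • (e : E), by
    have hinner : ⟪(x : E), e⟫ = sphereHeight e x := real_inner_comm _ _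
    have hsq : ‖(x : E) + (|sphereHeight e x| - sphereHeight e x) • (e : E)‖ ^ 2 = 1 := by
      rw [norm_add_sq_real, norm_smul, inner_smul_right, hinner, norm_eq_of_mem_sphere,
        norm_eq_of_mem_sphere, mul_one, Real.norm_eq_abs, sq_abs]
      linear_combination sq_abs (sphereHeight e x)
    rw [mem_sphere_zero_iff_norm]
    exact (pow_eq_one_iff_of_nonneg (norm_nonneg _) two_ne_zero).1 hsq⟩
  continuous_toFun := by fun_prop

theorem sphereFold_of_nonneg {x : sphere (0 : E) 1} (h : 0 ≤ sphereHeight e x) :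
    sphereFold e x = x :=
  Subtype.ext (by simp [sphereFold, abs_of_nonneg h])

theorem sphereFold_neg_of_nonpos {x : sphere (0 : E) 1} (h : sphereHeight e x ≤ 0) :
    sphereFold (-e) x = x :=
  sphereFold_of_nonneg _ (by rw [sphereHeight_neg]; linarith)

theorem sphereHeight_sphereFold (x : sphere (0 : E) 1) :
    sphereHeight e (sphereFold e x) = |sphereHeight e x| := by
  change ⟪(e : E), (x : E) + (|sphereHeight e x| - sphereHeight e x) • (e : E)⟫ = _
  rw [inner_add_right, inner_smul_right, real_inner_self_eq_norm_sq, norm_eq_of_mem_sphere]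
  change sphereHeight e x + _ = _
  ring

theorem nullhomotopic_sphereFold : (sphereFold e).Nullhomotopic := by
  refine nullhomotopic_of_forall_ne_neg _ e fun x hx => ?_
  have h := sphereHeight_sphereFold e x
  have hneg : sphereHeight e (-e) = -1 := by simp [sphereHeight]
  rw [hx, hneg] at h
  linarith [abs_nonneg (sphereHeight e x)]

/-- The points of the sphere that are orthogonal to `e`. -/
def equator : Set (sphere (0 : E) 1) := {x | sphereHeight e x = 0}

def equatorHomeomorph : equator e ≃ₜ sphere (0 : (ℝ ∙ (e : E))ᗮ) 1 where
  toFun x := ⟨⟨x, Submodule.mem_orthogonal_singleton_iff_inner_right.2 x.2⟩,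
    mem_sphere_zero_iff_norm.2 (norm_eq_of_mem_sphere x.1)⟩
  invFun y := ⟨⟨y, mem_sphere_zero_iff_norm.2 (norm_eq_of_mem_sphere y)⟩,
    Submodule.mem_orthogonal_singleton_iff_inner_right.1 y.1.2⟩
  left_inv _ := rfl
  right_inv _ := rfl
  continuous_toFun := by fun_prop
  continuous_invFun := by fun_prop

theorem finrank_orthogonal_add_one [FiniteDimensional ℝ E] :
    finrank ℝ (ℝ ∙ (e : E))ᗮ + 1 = finrank ℝ E := by
  rw [← Submodule.finrank_add_finrank_orthogonal (ℝ ∙ (e : E)), add_comm,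
    finrank_span_singleton (ne_zero_of_mem_unit_sphere e)]

theorem connectedSpace_equator [FiniteDimensional ℝ E] (hE : 2 < finrank ℝ E) :
    ConnectedSpace (equator e) := by
  have hrank : 1 < Module.rank ℝ (ℝ ∙ (e : E))ᗮ :=
    Module.lt_rank_of_lt_finrank (by have := finrank_orthogonal_add_one e; omega)
  have := isConnected_iff_connectedSpace.1
    (isConnected_sphere hrank (0 : (ℝ ∙ (e : E))ᗮ) zero_le_one)
  exact (equatorHomeomorph e).symm.surjective.connectedSpace (equatorHomeomorph e).symm.continuous

end Hemispheres

theorem AdmitsLog.sphere {E : Type*} [NormedAddCommGroup E] [InnerProductSpace ℝ E]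
    [FiniteDimensional ℝ E] (hE : 2 < finrank ℝ E) : AdmitsLog (sphere (0 : E) 1) := by
  intro u
  have : Nontrivial E := Module.nontrivial_of_finrank_pos (R := ℝ) (by omega)
  obtain ⟨v, hv⟩ := NormedSpace.sphere_nonempty (E := E) (x := 0).2 zero_le_one
  let e : Metric.sphere (0 : E) 1 := ⟨v, hv⟩
  have := connectedSpace_equator e hE
  obtain ⟨L₁, hL₁⟩ := exists_log_of_nullhomotopic _ ((nullhomotopic_sphereFold e).comp_right u)
  obtain ⟨L₂, hL₂⟩ := exists_log_of_nullhomotopic _ ((nullhomotopic_sphereFold (-e)).comp_right u)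
  have hL₁ (x) (hx : 0 ≤ sphereHeight e x) : exp (L₁ x) = u x := by
    rw [hL₁, ContinuousMap.comp_apply, sphereFold_of_nonneg e hx]
  have hL₂ (x) (hx : sphereHeight e x ≤ 0) : exp (L₂ x) = u x := by
    rw [hL₂, ContinuousMap.comp_apply, sphereFold_neg_of_nonpos e hx]
  have hdiff (x : equator e) : exp ((L₁ - L₂).restrict (equator e) x) = 1 := by
    simp [exp_sub, hL₁ x x.2.ge, hL₂ x x.2.le, (u x).2]
  obtain ⟨x₀⟩ : Nonempty (equator e) := inferInstance
  have hconst := fun x => eq_of_exp_eq_one _ hdiff x x₀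
  obtain ⟨L, hpos, hneg⟩ := exists_glue_of_eq_on_zero (sphereHeight e) L₁
    (L₂ + .const _ ((L₁ - L₂) x₀)) fun x hx => by
      rw [ContinuousMap.add_apply, ContinuousMap.const_apply]
      exact sub_eq_iff_eq_add'.1 (hconst ⟨x, hx⟩)
  refine ⟨L, fun x => (le_total 0 (sphereHeight e x)).elim (fun hx => ?_) fun hx => ?_⟩
  · rw [hpos x hx, hL₁ x hx]
  · rw [hneg x hx, ContinuousMap.add_apply, exp_add, hL₂ x hx, ContinuousMap.const_apply]
    exact (congrArg _ (hdiff x₀)).trans (mul_one _)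

/-! ### Lifting along maps with local transport -/

section LocalTransport

variable {A B X : Type*} [TopologicalSpace A] [TopologicalSpace B] [TopologicalSpace X]

/-- A map has local transport if a point over `b` can be moved, continuously in all the data, to a
point over any sufficiently close `b'`. The map `τ` need not fix a point that is already over `b'`:
it serves to lift whole families of maps and not to prolong given lifts. -/
def HasLocalTransport (p : A → B) : Prop :=
  ∃ N : Set (B × B), IsOpen N ∧ (∀ b, (b, b) ∈ N) ∧
    ∃ τ : C({q : A × B // (p q.1, q.2) ∈ N}, A), ∀ q, p (τ q) = q.1.2

theorem HasLocalTransport.exists_lift_of_homotopic [CompactSpace X] {p : A → B}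
    (hp : HasLocalTransport p) {f₀ f₁ : C(X, B)} (h : f₀.Homotopic f₁)
    (h₀ : ∃ g : C(X, A), ∀ x, p (g x) = f₀ x) : ∃ g : C(X, A), ∀ x, p (g x) = f₁ x := by
  obtain ⟨N, hN, hdiag, τ, hτ⟩ := hp
  obtain ⟨F⟩ := h
  let Lifts (t : I) : Prop := ∃ g : C(X, A), ∀ x, p (g x) = F (t, x)
  have transport {s t : I} (hst : ∀ x, (F (s, x), F (t, x)) ∈ N) : Lifts s → Lifts t := by
    rintro ⟨g, hg⟩
    exact ⟨τ.comp ⟨fun x => ⟨(g x, F (t, x)), by simpa only [hg] using hst x⟩, by fun_prop⟩,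
      fun x => hτ _⟩
  have near (t : I) : ∀ᶠ s in 𝓝 t, ∀ x ∈ Set.univ,
      (F (t, x), F (s, x)) ∈ N ∧ (F (s, x), F (t, x)) ∈ N :=
    isCompact_univ.eventually_forall_of_forall_eventually fun x _ =>
      (ContinuousAt.eventually_mem (f := fun q : I × X => (F (t, q.2), F q)) (by fun_prop)
        (hN.mem_nhds (hdiag _))).and
      (ContinuousAt.eventually_mem (f := fun q : I × X => (F q, F (t, q.2))) (by fun_prop)
        (hN.mem_nhds (hdiag _)))
  have all (s t : I) : Lifts s → Lifts t :=
    PreconnectedSpace.induction₂' (fun s t => Lifts s → Lifts t)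
      (fun t => (near t).mono fun s hs =>
        ⟨transport fun x => (hs x trivial).1, transport fun x => (hs x trivial).2⟩)
      ⟨fun _ _ _ h h' => h' ∘ h⟩ s t
  simpa [Lifts] using all 0 1 (by simpa [Lifts] using h₀)

theorem HasLocalTransport.exists_lift_of_nullhomotopic [CompactSpace X] {p : A → B}
    (hp : HasLocalTransport p) (hsurj : p.Surjective) {f : C(X, B)} (hf : f.Nullhomotopic) :
    ∃ g : C(X, A), ∀ x, p (g x) = f x :=
  let ⟨b, hb⟩ := hf
  let ⟨a, ha⟩ := hsurj b
  hp.exists_lift_of_homotopic hb.symm ⟨.const X a, fun _ => ha⟩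

end LocalTransport

/-! ### Triples of nonzero vectors and their tensor products -/

section Triples

variable {H : Type*} [NormedAddCommGroup H] [InnerProductSpace ℂ H]

/-- The vector `x` multiplied by `exp u`. -/
def expSMul (u : ℂ) (x : {x : H // x ≠ 0}) : {x : H // x ≠ 0} :=
  ⟨exp u • (x : H), smul_ne_zero (exp_ne_zero u) x.2⟩

theorem expSMul_zero (x : {x : H // x ≠ 0}) : expSMul 0 x = x :=
  Subtype.ext (by simp [expSMul])

theorem expSMul_add (u v : ℂ) (x : {x : H // x ≠ 0}) :
    expSMul (u + v) x = expSMul u (expSMul v x) :=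
  Subtype.ext (by simp [expSMul, exp_add, mul_smul])

@[fun_prop]
theorem continuous_expSMul {X : Type*} [TopologicalSpace X] {u : X → ℂ} {x : X → {x : H // x ≠ 0}}
    (hu : Continuous u) (hx : Continuous x) : Continuous fun t => expSMul (u t) (x t) := by
  unfold expSMul
  fun_prop

theorem expSMul_eq_expSMul_iff {u v : ℂ} {x : {x : H // x ≠ 0}} :
    expSMul u x = expSMul v x ↔ exp (u - v) = 1 := by
  rw [expSMul, expSMul, Subtype.mk_eq_mk, smul_left_inj x.2, exp_sub,
    div_eq_one_iff_eq (exp_ne_zero v)]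

theorem exists_eq_expSMul_of_admitsLog {X : Type*} [TopologicalSpace X] (hX : AdmitsLog X)
    (x y : C(X, {x : H // x ≠ 0})) (h : ∀ t, ∃ u, y t = expSMul u (x t)) :
    ∃ L : C(X, ℂ), ∀ t, y t = expSMul (L t) (x t) := by
  choose u hu using h
  have hinner (t : X) : inner ℂ (x t : H) (x t) ≠ 0 := inner_self_ne_zero.2 (x t).2
  have hratio (t : X) : inner ℂ (x t : H) (y t) / inner ℂ (x t : H) (x t) = exp (u t) := by
    rw [hu, expSMul, inner_smul_right, mul_div_cancel_right₀ _ (hinner t)]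
  obtain ⟨L, hL⟩ := hX ⟨fun t => ⟨inner ℂ (x t : H) (y t) / inner ℂ (x t : H) (x t),
    hratio t ▸ exp_ne_zero _⟩, by fun_prop (disch := assumption)⟩
  have hL (t : X) : exp (L t) = exp (u t) := (hL t).trans (hratio t)
  refine ⟨L, fun t => (hu t).trans (expSMul_eq_expSMul_iff.2 ?_)⟩
  rw [exp_sub, hL, div_self (exp_ne_zero _)]

/-- Triples of nonzero vectors, thought of as factors of a pure tensor. -/
abbrev Triple (H : Type*) [NormedAddCommGroup H] : Type _ :=
  {x : H // x ≠ 0} × {x : H // x ≠ 0} × {x : H // x ≠ 0}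

/-- Pairs `D` of complex numbers act by multiplying the three vectors by `exp (-(D.1 + D.2))`,
`exp D.1` and `exp D.2`. -/
instance : AddAction (ℂ × ℂ) (Triple H) where
  vadd D y := (expSMul (-(D.1 + D.2)) y.1, expSMul D.1 y.2.1, expSMul D.2 y.2.2)
  zero_vadd y := by
    change (expSMul _ _, expSMul _ _, expSMul _ _) = y
    simp [expSMul_zero]
  add_vadd D D' y := by
    refine Prod.ext (.trans ?_ (expSMul_add _ _ _))
      (Prod.ext (expSMul_add _ _ _) (expSMul_add _ _ _))
    change expSMul _ _ = expSMul _ _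
    congr 1
    simp only [Prod.fst_add, Prod.snd_add]
    ring

theorem vadd_triple (D : ℂ × ℂ) (y : Triple H) :
    D +ᵥ y = (expSMul (-(D.1 + D.2)) y.1, expSMul D.1 y.2.1, expSMul D.2 y.2.2) :=
  rfl

instance : ContinuousVAdd (ℂ × ℂ) (Triple H) where
  continuous_vadd := by
    simp only [vadd_triple]
    fun_prop

/-- The stabilizer of every triple. -/
def periods : AddSubgroup (ℂ × ℂ) where
  carrier := {D | exp D.1 = 1 ∧ exp D.2 = 1}
  zero_mem' := by simp
  add_mem' {D D'} hD hD' := by simp [exp_add, hD.1, hD.2, hD'.1, hD'.2]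
  neg_mem' {D} hD := by simp [exp_neg, hD.1, hD.2]

theorem vadd_eq_vadd_iff {D D' : ℂ × ℂ} {y : Triple H} :
    D +ᵥ y = D' +ᵥ y ↔ D - D' ∈ periods := by
  simp only [vadd_triple, Prod.ext_iff, expSMul_eq_expSMul_iff]
  refine ⟨fun h => h.2, fun h => ⟨?_, h⟩⟩
  rw [show -(D.1 + D.2) - -(D'.1 + D'.2) = -(D - D').1 + -(D - D').2 by simp; ring, exp_add,
    exp_neg, exp_neg, h.1, h.2]
  norm_num

theorem eq_of_mem_periods {X : Type*} [TopologicalSpace X] [PreconnectedSpace X]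
    (D : C(X, ℂ × ℂ)) (h : ∀ x, D x ∈ periods) (x y : X) : D x = D y :=
  Prod.ext (eq_of_exp_eq_one (ContinuousMap.fst.comp D) (fun x => (h x).1) x y)
    (eq_of_exp_eq_one (ContinuousMap.snd.comp D) (fun x => (h x).2) x y)

/-- The space of nonzero pure tensors `x ⊗ y ⊗ z`, as triples up to scalars with product one. -/
abbrev PureTensor (H : Type*) [NormedAddCommGroup H] [InnerProductSpace ℂ H] : Type _ :=
  AddAction.orbitRel.Quotient (ℂ × ℂ) (Triple H)

/-- The pure tensor with the given factors. -/
def toTensor (y : Triple H) : PureTensor H := Quotient.mk _ y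

theorem isOpenQuotientMap_toTensor : IsOpenQuotientMap (toTensor : Triple H → PureTensor H) :=
  AddAction.isOpenQuotientMap_quotientMk

@[fun_prop]
theorem continuous_toTensor : Continuous (toTensor : Triple H → PureTensor H) :=
  isOpenQuotientMap_toTensor.continuous

theorem toTensor_eq_iff {y y' : Triple H} : toTensor y = toTensor y' ↔ ∃ D : ℂ × ℂ, D +ᵥ y' = y :=
  Quotient.eq

@[simp]
theorem toTensor_vadd (D : ℂ × ℂ) (y : Triple H) : toTensor (D +ᵥ y) = toTensor y :=
  toTensor_eq_iff.2 ⟨D, rfl⟩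

theorem exists_eq_vadd_of_toTensor_eq {X : Type*} [TopologicalSpace X] (hX : AdmitsLog X)
    (y y' : C(X, Triple H)) (h : ∀ x, toTensor (y' x) = toTensor (y x)) :
    ∃ D : C(X, ℂ × ℂ), ∀ x, y' x = D x +ᵥ y x := by
  choose D hD using fun x => toTensor_eq_iff.1 (h x)
  obtain ⟨L₁, hL₁⟩ := exists_eq_expSMul_of_admitsLog hX ⟨fun x => (y x).2.1, by fun_prop⟩
    ⟨fun x => (y' x).2.1, by fun_prop⟩ fun x => ⟨(D x).1, congr(($(hD x)).2.1).symm⟩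
  obtain ⟨L₂, hL₂⟩ := exists_eq_expSMul_of_admitsLog hX ⟨fun x => (y x).2.2, by fun_prop⟩
    ⟨fun x => (y' x).2.2, by fun_prop⟩ fun x => ⟨(D x).2, congr(($(hD x)).2.2).symm⟩
  refine ⟨L₁.prodMk L₂, fun x => (hD x).symm.trans (vadd_eq_vadd_iff.2 ⟨?_, ?_⟩)⟩
  · exact expSMul_eq_expSMul_iff.1 (congr(($(hD x)).2.1).trans (hL₁ x))
  · exact expSMul_eq_expSMul_iff.1 (congr(($(hD x)).2.2).trans (hL₂ x))

/-- Neither the second nor the third factors of the two triples are orthogonal. -/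
def Facing (y y' : Triple H) : Prop :=
  inner ℂ (y.2.1 : H) (y'.2.1 : H) ≠ 0 ∧ inner ℂ (y.2.2 : H) (y'.2.2 : H) ≠ 0

theorem facing_self (y : Triple H) : Facing y y :=
  ⟨inner_self_ne_zero.2 y.2.1.2, inner_self_ne_zero.2 y.2.2.2⟩

theorem facing_vadd_vadd_iff {D D' : ℂ × ℂ} {y y' : Triple H} :
    Facing (D +ᵥ y) (D' +ᵥ y') ↔ Facing y y' := by
  simp [Facing, vadd_triple, expSMul, exp_ne_zero]

theorem isOpen_setOf_facing : IsOpen {q : Triple H × Triple H | Facing q.1 q.2} :=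
  (isOpen_ne_fun (by fun_prop) (by fun_prop)).inter (isOpen_ne_fun (by fun_prop) (by fun_prop))

/-- The representative of the pure tensor of `y'` whose second and third factors have inner product
one with those of `y`. -/
def alignTo (y y' : Triple H) (h : Facing y y') : Triple H :=
  (⟨(inner ℂ (y.2.1 : H) (y'.2.1 : H) * inner ℂ (y.2.2 : H) (y'.2.2 : H)) • (y'.1 : H),
      smul_ne_zero (mul_ne_zero h.1 h.2) y'.1.2⟩,
    ⟨(inner ℂ (y.2.1 : H) (y'.2.1 : H))⁻¹ • (y'.2.1 : H),
      smul_ne_zero (inv_ne_zero h.1) y'.2.1.2⟩,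
    ⟨(inner ℂ (y.2.2 : H) (y'.2.2 : H))⁻¹ • (y'.2.2 : H),
      smul_ne_zero (inv_ne_zero h.2) y'.2.2.2⟩)

theorem toTensor_alignTo {y y' : Triple H} (h : Facing y y') :
    toTensor (alignTo y y' h) = toTensor y' := by
  refine toTensor_eq_iff.2 ⟨(-log (inner ℂ (y.2.1 : H) (y'.2.1 : H)),
    -log (inner ℂ (y.2.2 : H) (y'.2.2 : H))), ?_⟩
  simp [vadd_triple, expSMul, alignTo, exp_add, exp_neg, exp_log h.1, exp_log h.2, mul_comm]

theorem alignTo_vadd {D : ℂ × ℂ} {y y' : Triple H} (h : Facing y y') (h' : Facing y (D +ᵥ y')) :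
    alignTo y (D +ᵥ y') h' = alignTo y y' h := by
  have hD₁ := exp_ne_zero D.1
  have hD₂ := exp_ne_zero D.2
  refine Prod.ext (Subtype.ext ?_) (Prod.ext (Subtype.ext ?_) (Subtype.ext ?_))
  all_goals
    simp only [alignTo, vadd_triple, expSMul, inner_smul_right, smul_smul, neg_add, exp_add,
      exp_neg]
    congr 1
    field_simp

theorem hasLocalTransport_toTensor :
    HasLocalTransport (toTensor : Triple H → PureTensor H) := by
  let N : Set (PureTensor H × PureTensor H) :=
    Prod.map toTensor toTensor '' {q : Triple H × Triple H | Facing q.1 q.2}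
  have hN : IsOpen N :=
    (isOpenQuotientMap_toTensor.prodMap isOpenQuotientMap_toTensor).isOpenMap _ isOpen_setOf_facing
  have facing_of_mem {y y' : Triple H} (h : (toTensor y, toTensor y') ∈ N) : Facing y y' := by
    obtain ⟨⟨w, w'⟩, hw, heq⟩ := h
    obtain ⟨D, rfl⟩ := toTensor_eq_iff.1 congr(($heq).1)
    obtain ⟨D', rfl⟩ := toTensor_eq_iff.1 congr(($heq).2)
    exact facing_vadd_vadd_iff.1 hw
  let S : Set (Triple H × PureTensor H) := {q | (toTensor q.1, q.2) ∈ N}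
  have hS : IsOpen S := hN.preimage (by fun_prop)
  have hpre := (IsOpenQuotientMap.id.prodMap
    isOpenQuotientMap_toTensor).isQuotientMap.restrictPreimage_isOpen hS
  let π : C(Prod.map id toTensor ⁻¹' S, S) := ⟨_, hpre.continuous⟩
  have hπ : IsQuotientMap π := hpre
  let align : C(Prod.map id toTensor ⁻¹' S, Triple H) :=
    ⟨fun q => alignTo q.1.1 q.1.2 (facing_of_mem q.2), by
      have h₁ := fun q : Prod.map id toTensor ⁻¹' S => (facing_of_mem q.2).1
      have h₂ := fun q : Prod.map id toTensor ⁻¹' S => (facing_of_mem q.2).2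
      unfold alignTo
      fun_prop (disch := assumption)⟩
  have align_eq : Function.FactorsThrough align π := by
    rintro ⟨⟨y, y'⟩, hy⟩ ⟨⟨w, w'⟩, hw⟩ h
    obtain rfl : y = w := congr(($h).1.1)
    obtain ⟨D, rfl⟩ := toTensor_eq_iff.1 (congr(($h).1.2) : toTensor y' = toTensor w')
    exact alignTo_vadd (facing_of_mem hw) (facing_of_mem hy)
  refine ⟨N, hN, fun b => ?_, hπ.lift align align_eq, fun q => ?_⟩
  · obtain ⟨y, rfl⟩ := isOpenQuotientMap_toTensor.surjective b
    exact ⟨(y, y), facing_self y, rfl⟩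
  · obtain ⟨q, rfl⟩ := hπ.surjective q
    exact (congrArg toTensor (DFunLike.congr_fun (hπ.lift_comp align align_eq) q)).trans
      (toTensor_alignTo (facing_of_mem q.2))

end Triples

/-! ### Asphericity of the space of pure tensors -/

section Asphericity

variable {H : Type*} [NormedAddCommGroup H] [InnerProductSpace ℂ H] {E : Type*}
  [NormedAddCommGroup E] [InnerProductSpace ℝ E] [FiniteDimensional ℝ E]

/-- Two lifts over the hemispheres differ over the equator by an element of `ℂ × ℂ`, which extends
over the sphere by Tietze's theorem, so that one lift can be corrected to agree with the other. -/
theorem exists_lift_toTensor_sphere (hE : 3 < finrank ℝ E)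
    (f : C(sphere (0 : E) 1, PureTensor H)) :
    ∃ g : C(sphere (0 : E) 1, Triple H), ∀ x, toTensor (g x) = f x := by
  have : Nontrivial E := Module.nontrivial_of_finrank_pos (R := ℝ) (by omega)
  obtain ⟨v, hv⟩ := (NormedSpace.sphere_nonempty (x := (0 : E))).2 zero_le_one
  let e : sphere (0 : E) 1 := ⟨v, hv⟩
  obtain ⟨g₁, hg₁⟩ := hasLocalTransport_toTensor.exists_lift_of_nullhomotopic
    isOpenQuotientMap_toTensor.surjective ((nullhomotopic_sphereFold e).comp_right f)
  obtain ⟨g₂, hg₂⟩ := hasLocalTransport_toTensor.exists_lift_of_nullhomotopic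
    isOpenQuotientMap_toTensor.surjective ((nullhomotopic_sphereFold (-e)).comp_right f)
  have hg₁ (x) (hx : 0 ≤ sphereHeight e x) : toTensor (g₁ x) = f x := by
    rw [hg₁, ContinuousMap.comp_apply, sphereFold_of_nonneg e hx]
  have hg₂ (x) (hx : sphereHeight e x ≤ 0) : toTensor (g₂ x) = f x := by
    rw [hg₂, ContinuousMap.comp_apply, sphereFold_neg_of_nonpos e hx]
  have admitsLog_equator : AdmitsLog (equator e) :=
    .of_homeomorph (equatorHomeomorph e)
      (.sphere (by have := finrank_orthogonal_add_one e; omega))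
  obtain ⟨D, hD⟩ := exists_eq_vadd_of_toTensor_eq admitsLog_equator (g₁.restrict _) (g₂.restrict _)
    fun x => (hg₂ x x.2.le).trans (hg₁ x x.2.ge).symm
  obtain ⟨D', rfl⟩ := D.exists_restrict_eq (isClosed_singleton.preimage (sphereHeight e).continuous)
  obtain ⟨g, hpos, hneg⟩ := exists_glue_of_eq_on_zero (sphereHeight e)
    ⟨fun x => D' x +ᵥ g₁ x, by fun_prop⟩ g₂ fun x hx => (hD ⟨x, hx⟩).symm
  refine ⟨g, fun x => (le_total 0 (sphereHeight e x)).elim (fun hx => ?_) fun hx => ?_⟩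
  · rw [hpos x hx, ContinuousMap.coe_mk, toTensor_vadd, hg₁ x hx]
  · rw [hneg x hx, hg₂ x hx]

theorem nullhomotopic_of_lift_toTensor [ContractibleSpace {x : H // x ≠ 0}] {X : Type*}
    [TopologicalSpace X] (f : C(X, PureTensor H))
    (h : ∃ g : C(X, Triple H), ∀ x, toTensor (g x) = f x) : f.Nullhomotopic := by
  obtain ⟨g, hg⟩ := h
  obtain rfl : ContinuousMap.comp ⟨toTensor, continuous_toTensor⟩ g = f := ContinuousMap.ext hg
  exact ((id_nullhomotopic (Triple H)).comp_left g).comp_right _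

theorem nullhomotopic_sphere_pureTensor [ContractibleSpace {x : H // x ≠ 0}]
    (hE : 3 < finrank ℝ E) (f : C(sphere (0 : E) 1, PureTensor H)) : f.Nullhomotopic :=
  nullhomotopic_of_lift_toTensor f (exists_lift_toTensor_sphere hE f)

end Asphericity

/-! ### Extending equivariant maps over cells -/

theorem exists_extend_closedBall_of_nullhomotopic {E Z : Type*} [NormedAddCommGroup E]
    [NormedSpace ℝ E] [ProperSpace E] [Nontrivial E] [TopologicalSpace Z]
    {f : C(sphere (0 : E) 1, Z)} (hf : f.Nullhomotopic) :
    ∃ g : C(closedBall (0 : E) 1, Z), ∀ x : sphere (0 : E) 1,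
      g ⟨x, sphere_subset_closedBall x.2⟩ = f x := by
  obtain ⟨z, ⟨F⟩⟩ := hf
  let π : C(I × sphere (0 : E) 1, closedBall (0 : E) 1) :=
    ⟨fun p => ⟨(p.1 : ℝ) • (p.2 : E), by
      simpa [norm_smul, abs_of_nonneg p.1.2.1] using p.1.2.2⟩, by fun_prop⟩
  have norm_π (p) : ‖(π p : E)‖ = p.1 := by simp [π, norm_smul, abs_of_nonneg p.1.2.1]
  have surjective_π : Function.Surjective π := by
    rintro ⟨b, hb⟩
    rw [mem_closedBall_zero_iff] at hb
    rcases eq_or_ne b 0 with rfl | hb0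
    · obtain ⟨x, hx⟩ := (NormedSpace.sphere_nonempty (x := (0 : E)) (r := 1)).2 zero_le_one
      exact ⟨(0, ⟨x, hx⟩), Subtype.ext (by simp [π])⟩
    · have hn : ‖b‖ ≠ 0 := norm_ne_zero_iff.2 hb0
      exact ⟨(⟨‖b‖, norm_nonneg b, hb⟩, ⟨‖b‖⁻¹ • b, by simp [norm_smul, hn]⟩),
        Subtype.ext (by simp [π, smul_smul, hn])⟩
  have isQuotientMap_π : IsQuotientMap π :=
    π.continuous.isClosedMap.isQuotientMap π.continuous surjective_π
  have factors : Function.FactorsThrough F.symm.toContinuousMap π := by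
    rintro ⟨s, x⟩ ⟨t, y⟩ h
    obtain rfl : s = t := Subtype.ext (by rw [← norm_π (s, x), h, norm_π])
    rcases eq_or_ne (s : ℝ) 0 with hs | hs
    · obtain rfl : s = 0 := Subtype.ext hs
      simp
    · obtain rfl : x = y := Subtype.ext (smul_right_injective E hs congr(($h : E)))
      rfl
  refine ⟨isQuotientMap_π.lift _ factors, fun x => ?_⟩
  have hx : (⟨x, sphere_subset_closedBall x.2⟩ : closedBall (0 : E) 1) = π (1, x) :=
    Subtype.ext (by simp [π])
  rw [hx]
  exact (DFunLike.congr_fun (isQuotientMap_π.lift_comp _ factors) (1, x)).trans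
    (F.symm.apply_one x)

theorem Z3Space.IsEquivariant.iterate {X Y : Z3Space} {f : C(X, Y)} (hf : IsEquivariant f) (n : ℕ)
    (x : X) : f (X.ω^[n] x) = Y.ω^[n] (f x) :=
  (Function.Semiconj.iterate_right (f := f) hf n) x

theorem Z3Space.IsEquivariant.exists_extend_attach {Y Z : Z3Space} {E : Type}
    [NormedAddCommGroup E] [NormedSpace ℝ E] [ProperSpace E] [Nontrivial E] {J : Type}
    (γ : J → C(sphere (0 : E) 1, Y)) {f : C(Y, Z)} (hf : IsEquivariant f)
    (h : ∀ i, (f.comp (γ i)).Nullhomotopic) :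
    ∃ F : C(attach Y γ, Z), IsEquivariant F ∧ ∀ y, F (attachIncl Y γ y) = f y := by
  choose g hg using fun i => exists_extend_closedBall_of_nullhomotopic (h i)
  let F₀ : Y ⊕ (Σ _ : J × ZMod 3, closedBall (0 : E) 1) → Z :=
    Sum.elim f fun p => Z.ω^[p.1.2.val] (g p.1.1 p.2)
  have continuous_F₀ : Continuous F₀ :=
    f.continuous.sumElim <| continuous_sigma fun p =>
      (Z.ω.continuous.iterate p.2.val).comp (g p.1).continuous
  have compatible (p q) (hpq : AttachRel Y γ p q) : F₀ p = F₀ q := by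
    obtain ⟨i, j, x⟩ := hpq
    exact (congrArg _ (hg i x)).trans (hf.iterate _ _).symm
  refine ⟨⟨Quot.lift F₀ compatible, continuous_quot_lift _ continuous_F₀⟩, ?_, fun y => rfl⟩
  rintro ⟨y | ⟨⟨i, j⟩, x⟩⟩
  · exact hf y
  · exact attach_shift Z j (g i x)

theorem exists_equivariant_P2 (c : GeneratorChoice) {Z : Z3Space} {f : C(circle3, Z)}
    (hf : IsEquivariant f) (hf' : (f.comp sphereToCircle).Nullhomotopic)
    (hZ : ∀ (m : ℕ) (g : C(sphere (0 : EuclideanSpace ℝ (Fin (m + 3 + 1))) 1, Z)),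
      g.Nullhomotopic) :
    ∃ F : C(P2 c, Z), IsEquivariant F := by
  obtain ⟨f₀, hf₀, -⟩ := hf.exists_extend_attach (fun _ : Unit => sphereToCircle) fun _ => hf'
  choose ext hext hincl using fun m (f : C(skeleton c m, Z)) (hf : IsEquivariant f) =>
    hf.exists_extend_attach (c m (skeleton c m)).γ fun _ => hZ m _
  let s (m : ℕ) : {f : C(skeleton c m, Z) // IsEquivariant f} :=
    Nat.rec ⟨f₀, hf₀⟩ (fun m f => ⟨ext m f.1 f.2, hext m f.1 f.2⟩) m
  refine ⟨⟨Quot.lift (fun p => (s p.1).1 p.2) ?_, continuous_quot_lift _ ?_⟩, ?_⟩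
  · rintro _ _ ⟨m, y⟩
    exact (hincl m (s m).1 (s m).2 y).symm
  · exact continuous_sigma fun m => (s m).1.continuous
  · rintro ⟨m, y⟩
    exact (s m).2 y

/-! ### The action on pure tensors -/

section Turn

variable {H : Type*} [NormedAddCommGroup H] [InnerProductSpace ℂ H]

theorem expSMul_neg_expSMul (u : ℂ) (x : {x : H // x ≠ 0}) : expSMul (-u) (expSMul u x) = x := by
  rw [← expSMul_add, neg_add_cancel, expSMul_zero]

/-- The cyclic permutation of the factors, followed by multiplication of the first one by the
primitive cube root of unity. -/
def turn : Triple H ≃ₜ Triple H where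
  toFun y := (expSMul (2 * Real.pi / 3 * Complex.I) y.2.2, y.1, y.2.1)
  invFun y := (y.2.1, y.2.2, expSMul (-(2 * Real.pi / 3 * Complex.I)) y.1)
  left_inv y := by simp [expSMul_neg_expSMul]
  right_inv y := by
    simpa using congr(($(expSMul_neg_expSMul (-(2 * Real.pi / 3 * Complex.I)) y.1), y.2))
  continuous_toFun := by fun_prop
  continuous_invFun := by fun_prop

/-- The linear map by which `turn` twists the action of `ℂ × ℂ`. -/
def turnExp : ℂ × ℂ →L[ℂ] ℂ × ℂ :=
  (-(ContinuousLinearMap.fst ℂ ℂ ℂ + ContinuousLinearMap.snd ℂ ℂ ℂ)).prod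
    (ContinuousLinearMap.fst ℂ ℂ ℂ)

theorem turnExp_apply (D : ℂ × ℂ) : turnExp D = (-(D.1 + D.2), D.1) := rfl

/-- The element of `ℂ × ℂ` that acts as the third iterate of `turn`. -/
def thirdExp : ℂ × ℂ := (2 * Real.pi / 3 * Complex.I, 2 * Real.pi / 3 * Complex.I)

theorem thirdExp_sub_turnExp : thirdExp - turnExp thirdExp = (2 * Real.pi * Complex.I, 0) := by
  ext <;> simp [thirdExp, turnExp_apply]
  ring

theorem turn_vadd (D : ℂ × ℂ) (y : Triple H) : turn (D +ᵥ y) = turnExp D +ᵥ turn y := by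
  refine Prod.ext ?_ (Prod.ext ?_ rfl)
  · change expSMul _ (expSMul _ _) = expSMul _ (expSMul _ _)
    rw [← expSMul_add, ← expSMul_add]
    congr 1
    simp only [turnExp_apply]
    ring
  · rfl

theorem turn_turn_turn (y : Triple H) : turn (turn (turn y)) = thirdExp +ᵥ y := by
  refine Prod.ext (expSMul_eq_expSMul_iff.2 ?_) rfl
  rw [exp_eq_one_iff]
  exact ⟨1, by simp only [thirdExp]; push_cast; ring⟩

end Turn

section TensorSpace

variable {H : Type} [NormedAddCommGroup H] [InnerProductSpace ℂ H]

/-- The space of pure tensors with the action induced by `turn`; the vector `e` only provides a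
base point. -/
def tensorSpace (e : {x : H // x ≠ 0}) : Z3Space where
  carrier := PureTensor H
  pt := toTensor (e, e, e)
  ω := ⟨Quotient.map turn (by rintro _ y ⟨D, rfl⟩; exact ⟨turnExp D, (turn_vadd D y).symm⟩),
    turn.continuous.quotient_map' _⟩
  ω_cube := by
    rintro ⟨y⟩
    exact (congrArg toTensor (turn_turn_turn y)).trans (toTensor_vadd _ _)

variable (e : {x : H // x ≠ 0})

theorem ω_toTensor (y : Triple H) : (tensorSpace e).ω (toTensor y) = toTensor (turn y) := rfl

/-- A lift of `circleToTensor` to triples. -/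
def circleToTriple : C(Circle, Triple H) :=
  ⟨fun z => (⟨(z : ℂ) • (e : H), smul_ne_zero z.coe_ne_zero e.2⟩, e, e), by fun_prop⟩

/-- The equivariant map `z ↦ (z • e) ⊗ e ⊗ e`. -/
def circleToTensor : C(circle3, tensorSpace e) :=
  ⟨fun z => toTensor (circleToTriple e z), continuous_toTensor.comp (circleToTriple e).continuous⟩

theorem isEquivariant_circleToTensor : IsEquivariant (circleToTensor e) := by
  intro (z : Circle)
  refine toTensor_eq_iff.2 ⟨(-log (z : ℂ), 0), ?_⟩
  have hz := z.coe_ne_zero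
  refine Prod.ext (Subtype.ext ?_) (Prod.ext (Subtype.ext ?_) (expSMul_zero e))
  · change exp (-(-log z + 0)) • exp _ • (e : H) = ((omega3 * z : Circle) : ℂ) • (e : H)
    rw [smul_smul, add_zero, neg_neg, exp_log hz, Circle.coe_mul, omega3, Circle.coe_exp, mul_comm]
    push_cast
    rfl
  · change exp (-log z) • (z : ℂ) • (e : H) = e
    rw [smul_smul, exp_neg, exp_log hz, inv_mul_cancel₀ hz, one_smul]

theorem exists_equivariant_P2_tensorSpace [ContractibleSpace {x : H // x ≠ 0}]
    (c : GeneratorChoice) : ∃ F : C(P2 c, tensorSpace e), IsEquivariant F :=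
  exists_equivariant_P2 c (isEquivariant_circleToTensor e)
    (nullhomotopic_of_lift_toTensor _ ⟨(circleToTriple e).comp sphereToCircle, fun _ => rfl⟩)
    fun m g => nullhomotopic_sphere_pureTensor (by simp) g

end TensorSpace

/-! ### Lifting equivariant paths -/

theorem exists_extend_real_of_apply_one_eq {E : Type*} [TopologicalSpace E] (T : E ≃ₜ E)
    (Z : C(I, E)) (hZ : Z 1 = T (Z 0)) :
    ∃ y : C(ℝ, E), (∀ x, y (x + 1) = T (y x)) ∧ ∀ s : I, y s = Z s := by
  let piece (n : ℤ) (x : ℝ) : E := (T ^ n) (Set.projIcc 0 1 zero_le_one (x - n) |> Z)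
  have piece_add_one (n : ℤ) (x : ℝ) : piece (n + 1) (x + 1) = T (piece n x) := by
    simp only [piece, add_comm n 1, zpow_one_add]
    rw [Int.cast_add, Int.cast_one, add_comm (1 : ℝ), add_sub_add_right_eq_sub]
    rfl
  have piece_floor {n : ℤ} {x : ℝ} (hx : x ∈ Set.Icc (n : ℝ) (n + 1)) :
      piece ⌊x⌋ x = piece n x := by
    rcases hx.2.eq_or_lt with rfl | h
    · have hfloor : ⌊(n : ℝ) + 1⌋ = n + 1 := by exact_mod_cast Int.floor_intCast (n + 1)
      rw [hfloor]
      simpa [piece, zpow_add_one] using congrArg (T ^ n) hZ.symm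
    · rw [Int.floor_eq_iff.2 ⟨hx.1, h⟩]
  have continuous_piece (n : ℤ) : Continuous (piece n) :=
    (T ^ n).continuous.comp (Z.continuous.comp (continuous_projIcc.comp (by fun_prop)))
  have locallyFinite : LocallyFinite fun n : ℤ => Set.Icc (n : ℝ) (n + 1) :=
    locallyFinite_Icc_of_tendsto tendsto_intCast_atTop_atTop
      (tendsto_atBot_add_const_right _ _ (tendsto_intCast_atBot_iff.2 tendsto_id))
  refine ⟨⟨fun x => piece ⌊x⌋ x, locallyFinite.continuous (iUnion_Icc_intCast ℝ)
    (fun _ => isClosed_Icc) fun n => (continuous_piece n).continuousOn.congr fun x => piece_floor⟩,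
    fun x => ?_, fun s => ?_⟩
  · simp only [ContinuousMap.coe_mk, Int.floor_add_one, piece_add_one]
  · exact (piece_floor (n := 0) (by simp)).trans (by simp [piece])

theorem Z3Space.ω_injective (X : Z3Space) : Function.Injective X.ω := fun x y h => by
  rw [← X.ω_cube x, h, X.ω_cube]

instance : ContractibleSpace I := (convex_Icc (0 : ℝ) 1).contractibleSpace ⟨0, by simp⟩

section EquivariantLift

variable {H : Type} [NormedAddCommGroup H] [InnerProductSpace ℂ H] {e : {x : H // x ≠ 0}}

theorem exists_lift_toTensor {X : Type*} [TopologicalSpace X] [CompactSpace X] [ContractibleSpace X]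
    (f : C(X, PureTensor H)) : ∃ g : C(X, Triple H), ∀ x, toTensor (g x) = f x :=
  hasLocalTransport_toTensor.exists_lift_of_nullhomotopic isOpenQuotientMap_toTensor.surjective
    ((id_nullhomotopic X).comp_right f)

theorem exists_turn_semiconj_lift (l : C(ℝ, tensorSpace e))
    (hl : ∀ x, l (x + 1) = (tensorSpace e).ω (l x)) :
    ∃ y : C(ℝ, Triple H), (∀ x, y (x + 1) = turn (y x)) ∧ ∀ x, toTensor (y x) = l x := by
  obtain ⟨Y, hY⟩ := exists_lift_toTensor (l.comp ⟨((↑) : I → ℝ), continuous_subtype_val⟩)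
  obtain ⟨D, hD⟩ : ∃ D : ℂ × ℂ, D +ᵥ turn (Y 0) = Y 1 := by
    rw [← toTensor_eq_iff, ← ω_toTensor e, hY, hY]
    exact (congrArg l (zero_add 1).symm).trans (hl 0)
  obtain ⟨y, hturn, hy⟩ := exists_extend_real_of_apply_one_eq turn
    ⟨fun s : I => (-((s : ℝ) : ℂ) • D) +ᵥ Y s, by fun_prop⟩ (by simp [← hD])
  refine ⟨y, hturn, fun x => ?_⟩
  have periodic : Function.Periodic (fun x => toTensor (y x) = l x) 1 := fun x => by
    simp only [hturn, hl, ← ω_toTensor e]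
    exact propext (tensorSpace e).ω_injective.eq_iff
  have lift_fract : toTensor (y (Int.fract x)) = l (Int.fract x) := by
    rw [hy ⟨Int.fract x, Int.fract_nonneg x, (Int.fract_lt_one x).le⟩]
    exact (toTensor_vadd _ _).trans (hY _)
  have fract_iff := periodic.sub_int_mul_eq (x := x) ⌊x⌋
  rw [mul_one] at fract_iff
  exact fract_iff.mp lift_fract

theorem apply_add_three_mul_of_turn {y : ℝ → Triple H} (hy : ∀ x, y (x + 1) = turn (y x)) (a : ℤ)
    (x : ℝ) : y (x + 3 * a) = (a : ℂ) • thirdExp +ᵥ y x := by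
  let w (x : ℝ) : Triple H := (-(x / 3 : ℂ)) • thirdExp +ᵥ y x
  have hw (x : ℝ) : y x = (x / 3 : ℂ) • thirdExp +ᵥ w x := by simp [w]
  have periodic_w : w.Periodic 3 := fun x => by
    have : y (x + 3) = thirdExp +ᵥ y x := by
      rw [← turn_turn_turn, ← hy, ← hy, ← hy]
      ring_nf
    simp only [w, this, vadd_vadd]
    congr 1
    push_cast
    module
  rw [hw, mul_comm, periodic_w.int_mul a x]
  conv_rhs => rw [hw x, vadd_vadd]
  congr 1
  push_cast
  module

end EquivariantLift

/-! ### The monodromy defect -/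

section MonodromyDefect

/-- The failure of the monodromies `G` (in the second direction of a square) and `K` (in the first
one, up to `turn`) to commute. -/
def monodromyDefect (G K : C(I, ℂ × ℂ)) : ℂ × ℂ := G 1 - turnExp (G 0) - (K 1 - K 0)

variable {H : Type} [NormedAddCommGroup H] [InnerProductSpace ℂ H]

/-- The lift `Y` of a square with boundary identifications has monodromies `G` and `K`. -/
structure HasMonodromy (Y : C(I × I, Triple H)) (G K : C(I, ℂ × ℂ)) : Prop where
  vertical : ∀ s, Y (s, 1) = G s +ᵥ Y (s, 0)
  horizontal : ∀ t, Y (1, t) = K t +ᵥ turn (Y (0, t))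

theorem HasMonodromy.defect_mem_periods {Y : C(I × I, Triple H)} {G K : C(I, ℂ × ℂ)}
    (h : HasMonodromy Y G K) : monodromyDefect G K ∈ periods := by
  have corner : (G 1 + K 0) +ᵥ turn (Y (0, 0)) = (K 1 + turnExp (G 0)) +ᵥ turn (Y (0, 0)) := by
    rw [add_vadd, ← h.horizontal, ← h.vertical, h.horizontal, h.vertical, turn_vadd, vadd_vadd]
  have := vadd_eq_vadd_iff.1 corner
  rwa [show G 1 + K 0 - (K 1 + turnExp (G 0)) = monodromyDefect G K by
    rw [monodromyDefect]; abel] at this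

theorem HasMonodromy.exists_defect_sub_eq {Y Y' : C(I × I, Triple H)} {G K G' K' : C(I, ℂ × ℂ)}
    (h : HasMonodromy Y G K) (h' : HasMonodromy Y' G' K')
    (hY : ∀ p, toTensor (Y' p) = toTensor (Y p)) :
    ∃ m ∈ periods, monodromyDefect G' K' - monodromyDefect G K = m - turnExp m := by
  obtain ⟨D, hD⟩ := exists_eq_vadd_of_toTensor_eq .of_contractibleSpace Y Y' hY
  let m : C(I, ℂ × ℂ) := ⟨fun s => G' s + D (s, 0) - (D (s, 1) + G s), by fun_prop⟩
  let k : C(I, ℂ × ℂ) := ⟨fun t => K' t + turnExp (D (0, t)) - (D (1, t) + K t), by fun_prop⟩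
  have m_mem (s) : m s ∈ periods := (vadd_eq_vadd_iff (y := Y (s, 0))).1 <| by
    rw [add_vadd, ← hD, ← h'.vertical, hD, h.vertical, vadd_vadd]
  have k_mem (t) : k t ∈ periods := (vadd_eq_vadd_iff (y := turn (Y (0, t)))).1 <| by
    rw [add_vadd, ← turn_vadd, ← hD, ← h'.horizontal, hD, h.horizontal, vadd_vadd]
  have hm : G' 0 + D (0, 0) - (D (0, 1) + G 0) = m 1 := eq_of_mem_periods m m_mem 0 1
  have hk : k 0 = k 1 := eq_of_mem_periods k k_mem 0 1
  refine ⟨m 1, m_mem 1, ?_⟩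
  nth_rw 2 [← hm]
  simp only [m, k, monodromyDefect, ContinuousMap.coe_mk, map_sub, map_add] at hk ⊢
  linear_combination hk

/-- The square `F`, whose opposite sides are identified by the identity and by the action, has a
lift to `Triple H` with monodromy defect `δ`. -/
def HasDefect (F : C(I × I, PureTensor H)) (δ : ℂ × ℂ) : Prop :=
  ∃ (Y : C(I × I, Triple H)) (G K : C(I, ℂ × ℂ)),
    (∀ p, toTensor (Y p) = F p) ∧ HasMonodromy Y G K ∧ monodromyDefect G K = δ

theorem HasDefect.exists_sub_eq {F : C(I × I, PureTensor H)} {δ δ' : ℂ × ℂ} (h : HasDefect F δ)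
    (h' : HasDefect F δ') : ∃ m ∈ periods, δ' - δ = m - turnExp m := by
  obtain ⟨Y, G, K, hY, hG, rfl⟩ := h
  obtain ⟨Y', G', K', hY', hG', rfl⟩ := h'
  exact hG.exists_defect_sub_eq hG' fun p => (hY' p).trans (hY p).symm

variable {e : {x : H // x ≠ 0}}

theorem exists_hasDefect_of_homotopy (F : C(I × I × I, tensorSpace e))
    (vertical : ∀ r s, F (r, s, 1) = F (r, s, 0))
    (horizontal : ∀ r t, F (r, 1, t) = (tensorSpace e).ω (F (r, 0, t))) :
    ∃ δ, ∀ r, HasDefect (F.curry r) δ := by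
  obtain ⟨Y, hY⟩ := exists_lift_toTensor F
  obtain ⟨G, hG⟩ := exists_eq_vadd_of_toTensor_eq .of_contractibleSpace
    (Y.comp ⟨fun p : I × I => (p.1, p.2, 0), by fun_prop⟩)
    (Y.comp ⟨fun p : I × I => (p.1, p.2, 1), by fun_prop⟩)
    fun p => (hY _).trans ((vertical _ _).trans (hY _).symm)
  obtain ⟨K, hK⟩ := exists_eq_vadd_of_toTensor_eq .of_contractibleSpace
    ⟨fun p : I × I => turn (Y (p.1, 0, p.2)), by fun_prop⟩
    (Y.comp ⟨fun p : I × I => (p.1, 1, p.2), by fun_prop⟩)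
    fun p => (hY _).trans ((horizontal _ _).trans
      (congrArg (tensorSpace e).ω (hY (p.1, 0, p.2)).symm))
  have monodromy (r) : HasMonodromy (Y.curry r) (G.curry r) (K.curry r) :=
    ⟨fun s => hG (r, s), fun t => hK (r, t)⟩
  let δ : C(I, ℂ × ℂ) := ⟨fun r => monodromyDefect (G.curry r) (K.curry r), by
    simp only [monodromyDefect, ContinuousMap.curry_apply]
    fun_prop⟩
  exact ⟨δ 0, fun r => ⟨Y.curry r, G.curry r, K.curry r, fun p => hY (r, p), monodromy r,
    eq_of_mem_periods δ (fun r => (monodromy r).defect_mem_periods) r 0⟩⟩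

theorem hasDefect_of_affine {l : C(ℝ, tensorSpace e)}
    (hl : ∀ x, l (x + 1) = (tensorSpace e).ω (l x)) {A a : ℤ} (hA : (A : ZMod 3) = 1)
    {F : C(I × I, PureTensor H)} (hF : ∀ s t : I, F (s, t) = l (A * s + 3 * a * t)) :
    HasDefect F ((a : ℂ) • (2 * Real.pi * Complex.I, 0)) := by
  obtain ⟨y, hturn, hy⟩ := exists_turn_semiconj_lift l hl
  obtain ⟨A', rfl⟩ : ∃ A', A = 1 + 3 * A' := by
    obtain ⟨k, hk⟩ := (ZMod.intCast_eq_intCast_iff_dvd_sub 1 A 3).1 (by simpa using hA.symm)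
    exact ⟨k, by linear_combination hk⟩
  refine ⟨y.comp ⟨fun p => (1 + 3 * A' : ℤ) * p.1 + 3 * a * p.2, by fun_prop⟩,
    .const I ((a : ℂ) • thirdExp), .const I (turnExp ((A' : ℂ) • thirdExp)),
    fun p => (hy _).trans (hF p.1 p.2).symm, ⟨fun s => ?_, fun t => ?_⟩, ?_⟩
  · simpa using apply_add_three_mul_of_turn hturn a _
  · change y _ = turnExp _ +ᵥ turn (y _)
    rw [← turn_vadd, ← apply_add_three_mul_of_turn hturn, ← hturn]
    congr 1
    simp only [ContinuousMap.coe_mk, Set.Icc.coe_one, Set.Icc.coe_zero]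
    push_cast
    ring
  · simp [monodromyDefect, ← thirdExp_sub_turnExp, smul_sub]

theorem intCast_eq_of_sub_eq {a b : ℤ} {m : ℂ × ℂ} (hm : m ∈ periods)
    (h : (a : ℂ) • ((2 * Real.pi * Complex.I, 0) : ℂ × ℂ) - (b : ℂ) • (2 * Real.pi * Complex.I, 0) =
      m - turnExp m) : (a : ZMod 3) = b := by
  obtain ⟨p, hp⟩ := exp_eq_one_iff.1 hm.1
  have h₁ := congrArg Prod.fst h
  have h₂ := congrArg Prod.snd h
  simp only [turnExp_apply, Prod.smul_mk, smul_eq_mul, mul_zero, Prod.mk_sub_mk, sub_self,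
    Prod.fst_sub, Prod.snd_sub] at h₁ h₂
  have hab : ((a : ℂ) - b) = 3 * p := mul_right_cancel₀ two_pi_I_ne_zero <| by
    linear_combination h₁ - h₂ + 3 * hp
  have hab : a - b = 3 * p := by exact_mod_cast hab
  exact ((ZMod.intCast_eq_intCast_iff_dvd_sub _ _ 3).2 ⟨p, by push_cast; exact hab⟩).symm

end MonodromyDefect

/-! ### Monomials on squares in the torus -/

/-- The path in the circle that runs through a third of the circle, from `z` to `ω z`, on each
interval of length one. -/
def thirdTurn : C(ℝ, circle3) :=
  ⟨fun x => Circle.exp (2 * Real.pi / 3 * x), Circle.exp.continuous.comp (by fun_prop)⟩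

theorem thirdTurn_add_one (x : ℝ) : thirdTurn (x + 1) = circle3.ω (thirdTurn x) := by
  change Circle.exp _ = Circle.exp _ * Circle.exp _
  rw [← Circle.exp_add]
  congr 1
  ring

theorem thirdTurn_add_three (x : ℝ) : thirdTurn (x + 3) = thirdTurn x := by
  rw [show x + 3 = x + 1 + 1 + 1 by ring, thirdTurn_add_one, thirdTurn_add_one, thirdTurn_add_one,
    circle3.ω_cube]

theorem monomial_thirdTurn {n : ℕ} (a : Fin n → ℤ) (x : Fin n → ℝ) :
    monomial a (fun j => thirdTurn (x j)) = thirdTurn (∑ j, a j * x j) := by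
  change ∏ j, Circle.exp (2 * Real.pi / 3 * x j) ^ a j = Circle.exp (2 * Real.pi / 3 * _)
  have exp_sum : Circle.exp (∑ j, a j * (2 * Real.pi / 3 * x j)) =
      ∏ j, Circle.exp (a j * (2 * Real.pi / 3 * x j)) := map_sum Circle.expHom _ _
  simp only [Finset.mul_sum, mul_left_comm _ (a _ : ℝ), exp_sum, Circle.exp_intCast_mul]

/-- The square in the torus that runs along the diagonal in the first direction, from `z` to `ω z`,
and once around the `i`-th circle in the second one. -/
def torusSquare {n : ℕ} (i : Fin n) : C(I × I, torus n) :=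
  ⟨fun p j => thirdTurn (p.1 + if j = i then 3 * (p.2 : ℝ) else 0),
    continuous_pi fun j => thirdTurn.continuous.comp (by split_ifs <;> fun_prop)⟩

section TorusSquare

variable {n : ℕ} (i : Fin n)

theorem torusSquare_one_right (s : I) : torusSquare i (s, 1) = torusSquare i (s, 0) := by
  funext j
  change thirdTurn (s + if j = i then 3 * (1 : ℝ) else 0) =
    thirdTurn (s + if j = i then 3 * (0 : ℝ) else 0)
  split_ifs <;> simp [thirdTurn_add_three]

theorem torusSquare_one_left (t : I) :
    torusSquare i (1, t) = (torus n).ω (torusSquare i (0, t)) := by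
  funext j
  refine (congrArg thirdTurn ?_).trans (thirdTurn_add_one _)
  rw [Set.Icc.coe_one, Set.Icc.coe_zero, zero_add, add_comm]

theorem monomial_torusSquare (a : Fin n → ℤ) (s t : I) :
    monomial a (torusSquare i (s, t)) = thirdTurn ((∑ j, a j : ℤ) * s + 3 * a i * t) := by
  refine (monomial_thirdTurn a _).trans (congrArg thirdTurn ?_)
  simp only [mul_add, mul_ite, mul_zero, Finset.sum_add_distrib, Finset.sum_ite_eq',
    Finset.mem_univ, if_true, Int.cast_sum, Finset.sum_mul]
  ring

end TorusSquare

theorem Z3Space.EquivariantlyHomotopic.postcomp {X Y Z : Z3Space} {f g : C(X, Y)}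
    (h : EquivariantlyHomotopic f g) {Φ : C(Y, Z)} (hΦ : IsEquivariant Φ) :
    EquivariantlyHomotopic (Φ.comp f) (Φ.comp g) := by
  obtain ⟨F, hF⟩ := h
  exact ⟨(ContinuousMap.Homotopy.refl Φ).comp F, fun t x => (congrArg Φ (hF t x)).trans (hΦ _)⟩

theorem intCast_eq_of_equivariantlyHomotopic_tensorSpace {H : Type} [NormedAddCommGroup H]
    [InnerProductSpace ℂ H] {e : {x : H // x ≠ 0}} {κ : C(circle3, tensorSpace e)}
    (hκ : IsEquivariant κ) {n : ℕ} {a b : Fin n → ℤ} (ha : ∑ i, (a i : ZMod 3) = 1)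
    (hb : ∑ i, (b i : ZMod 3) = 1)
    (h : EquivariantlyHomotopic (monomialMap κ a) (monomialMap κ b)) (i : Fin n) :
    (a i : ZMod 3) = b i := by
  obtain ⟨h, hω⟩ := h
  let F : C(I × I × I, tensorSpace e) :=
    h.toContinuousMap.comp ((ContinuousMap.id I).prodMap (torusSquare i))
  have path_add_one (x : ℝ) :
      κ.comp thirdTurn (x + 1) = (tensorSpace e).ω (κ.comp thirdTurn x) :=
    (congrArg κ (thirdTurn_add_one x)).trans (hκ _)
  obtain ⟨δ, hδ⟩ := exists_hasDefect_of_homotopy F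
    (fun r s => congrArg (fun z => h (r, z)) (torusSquare_one_right i s))
    (fun r t => (congrArg (fun z => h (r, z)) (torusSquare_one_left i t)).trans (hω r _))
  obtain ⟨m, hm, hma⟩ := (hδ 0).exists_sub_eq <|
    hasDefect_of_affine path_add_one (A := ∑ j, a j) (by exact_mod_cast ha) fun s t =>
      (h.apply_zero _).trans (congrArg κ (monomial_torusSquare i a s t))
  obtain ⟨m', hm', hmb⟩ := (hδ 1).exists_sub_eq <|
    hasDefect_of_affine path_add_one (A := ∑ j, b j) (by exact_mod_cast hb) fun s t =>
      (h.apply_one _).trans (congrArg κ (monomial_torusSquare i b s t))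
  exact intCast_eq_of_sub_eq (sub_mem hm hm') (by rw [map_sub]; linear_combination hma - hmb)

theorem mainTheorem5_general (c : GeneratorChoice) {ι : C(circle3, P2 c)} (hι : IsEquivariant ι)
    {n : ℕ} {a b : Fin n → ℤ} (ha : ∑ i, (a i : ZMod 3) = 1) (hb : ∑ i, (b i : ZMod 3) = 1)
    (h : EquivariantlyHomotopic (monomialMap ι a) (monomialMap ι b)) (i : Fin n) :
    (a i : ZMod 3) = b i := by
  obtain ⟨e⟩ : Nonempty {x : SquareSummable // x ≠ 0} := inferInstance
  obtain ⟨Φ, hΦ⟩ := exists_equivariant_P2_tensorSpace e c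
  exact intCast_eq_of_equivariantlyHomotopic_tensorSpace (κ := Φ.comp ι)
    (fun z => (congrArg Φ (hι z)).trans (hΦ _)) ha hb (h.postcomp hΦ) i

theorem mainTheorem5 (c : GeneratorChoice) (ι : C(circle3, P2 c))
    (hι : Topology.IsEmbedding ι) (hιω : IsEquivariant ι)
    (n : ℕ) (α β : Fin n → ZMod 3) (hα : α ∈ AffineTuples n) (hβ : β ∈ AffineTuples n)
    (h : EquivariantlyHomotopic (monomialMap3 ι α) (monomialMap3 ι β)) :
    α = β := by
  funext i
  simpa using mainTheorem5_general c hιω (by simpa [AffineTuples] using hα)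
    (by simpa [AffineTuples] using hβ) h i
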